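/- Let $k$ be an algebraically closed field of characteristic $0$. For $n\ge 1$ let $S_n$ be the group of permutations of $\{1,\dots,n\}$, let $C_n=\langle a\rangle\subset S_n$ be the subgroup generated by the $n$-cycle $a=(1\,2\,\cdots\,n)$, and let $S_{n-1}\subset S_n$ be the subgroup of permutations that fix $n$. Every element of $S_n$ is uniquely a product of an element of $C_n$ and an element of $S_{n-1}$, so that for $x\in S_{n-1}$ and $b\in C_n$ there are unique $x\rhd b\in C_n$ and $x\lhd b\in S_{n-1}$ with $xb=(x\rhd b)(x\lhd b)$. Let $J_n=k^{S_{n-1}}\#kC_n$ be the associated bismash product Hopf algebra: it has the $k$-basis $p_x\#b$ ($x\in S_{n-1}$, $b\in C_n$), with $$(p_x\#b)(p_y\#c)=\delta_{y,\,x\lhd b}\;p_x\#bc,\qquad 1=\sum_{x}p_x\#1,\qquad \varepsilon(p_x\#b)=\delta_{x,1},$$ $$\Delta(p_x\#b)=\sum_{y\in S_{n-1}}\bigl(p_{xy^{-1}}\#(y\rhd b)\bigr)\otimes(p_y\#b),\qquad S(p_x\#b)=p_{(x\lhd b)^{-1}}\#(x\rhd b)^{-1}.$$ An irrep of $J_n$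 is a simple $J_n$-module, taken up to isomorphism; its dimension is its dimension over $k$. The Frobenius--Schur indicator of an irrep with character $\chi$ is $\nu(\chi)=\chi\bigl(\sum\Lambda_1\Lambda_2\bigr)$, where $\Delta(\Lambda)=\sum\Lambda_1\otimes\Lambda_2$ and $\Lambda$ is the unique element of $J_n$ with $h\Lambda=\varepsilon(h)\Lambda=\Lambda h$ for all $h\in J_n$ and $\varepsilon(\Lambda)=1$; it takes values in $\{1,0,-1\}$. Theorem. Let $n=2m$ with $m\ge 1$. The number of $2$-dimensional irreps of $J_n$ is finite, it is nonzero for $m\ge 3$, and the ratio of the number of $2$-dimensional irreps of $J_n$ with indicator $+1$ or $-1$ (that is, with nonzero indicator) to the total number of $2$-dimensional irreps of $J_n$ converges to $0$ as $m\to\infty$. -/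

import Mathlib

open scoped TensorProduct

noncomputable section

/-! ### Matched pairs of groups -/

/-- A matched pair of groups `(F, G, ▷, ◁)`: `lact x a = x ▷ a` is a left action of `G` on the
set `F`, `ract x a = x ◁ a` is a right action of `F` on the set `G`, with the two compatibilities
`x ▷ ab = (x ▷ a)((x ◁ a) ▷ b)` and `xy ◁ a = (x ◁ (y ▷ a))(y ◁ a)`. -/
@[ext] structure MatchedPair (F G : Type*) [Group F] [Group G] where
  lact : G → F → F
  ract : G → F → G
  one_lact : ∀ a, lact 1 a = a
  mul_lact : ∀ x y a, lact (x * y) a = lact x (lact y a)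
  ract_one : ∀ x, ract x 1 = x
  ract_mul : ∀ x a b, ract x (a * b) = ract (ract x a) b
  lact_mul : ∀ x a b, lact x (a * b) = lact x a * lact (ract x a) b
  mul_ract : ∀ x y a, ract (x * y) a = ract x (lact y a) * ract y a

namespace MatchedPair

variable {F G : Type*} [Group F] [Group G] (P : MatchedPair F G)

theorem lact_one (x : G) : P.lact x 1 = 1 := by
  have h := P.lact_mul x 1 1
  rw [P.ract_one, mul_one] at h
  exact left_eq_mul.mp h

theorem one_ract (a : F) : P.ract 1 a = 1 := by
  have h := P.mul_ract 1 1 a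
  rw [P.one_lact, mul_one] at h
  exact left_eq_mul.mp h

theorem ract_injective (a : F) : Function.Injective fun x => P.ract x a := by
  intro x y h
  have h' := congrArg (fun z => P.ract z a⁻¹) h
  simpa only [← P.ract_mul, mul_inv_cancel, P.ract_one] using h'

theorem ract_surjective (a : F) : Function.Surjective fun x => P.ract x a := fun y =>
  ⟨P.ract y a⁻¹, by simp only [← P.ract_mul, inv_mul_cancel, P.ract_one]⟩

theorem ract_mul_inv (x y : G) (a : F) :
    P.ract (x * y⁻¹) (P.lact y a) = P.ract x a * (P.ract y a)⁻¹ := by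
  rw [eq_mul_inv_iff_mul_eq, ← P.mul_ract, inv_mul_cancel_right]

theorem lact_mul_inv (x y : G) (a : F) : P.lact (x * y⁻¹) (P.lact y a) = P.lact x a := by
  rw [← P.mul_lact, inv_mul_cancel_right]

end MatchedPair

/-- If `L = FG` with `F ∩ G = 1`, then for `x ∈ G`, `b ∈ F` the element `x b` is uniquely
`x b = (x ▷ b)(x ◁ b)` with `x ▷ b ∈ F`, `x ◁ b ∈ G`; this makes `(F, G)` a matched pair. -/
def MatchedPair.ofIsComplement {L : Type*} [Group L] {F G : Subgroup L}
    (h : Subgroup.IsComplement' F G) : MatchedPair F G :=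
  have key : ∀ (x : G) (b : F) (c : F) (y : G), (x : L) * b = c * y →
      h.equiv ((x : L) * b) = (c, y) := by
    intro x b c y e
    rw [← Equiv.eq_symm_apply, e]
    rfl
  have spec : ∀ (x : G) (b : F),
      (x : L) * b = ((h.equiv ((x : L) * b)).1 : L) * ((h.equiv ((x : L) * b)).2 : L) :=
    fun x b => (h.equiv_fst_mul_equiv_snd _).symm
  have one_left : ∀ a : F, h.equiv (((1 : G) : L) * a) = (a, 1) := fun a =>
    key 1 a a 1 (by simp)
  have one_right : ∀ x : G, h.equiv ((x : L) * ((1 : F) : L)) = (1, x) := fun x =>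
    key x 1 1 x (by simp)
  have mul_left : ∀ (x y : G) (a : F), h.equiv (((x * y : G) : L) * a) =
      ((h.equiv ((x : L) * ((h.equiv ((y : L) * a)).1 : L))).1,
        (h.equiv ((x : L) * ((h.equiv ((y : L) * a)).1 : L))).2 * (h.equiv ((y : L) * a)).2) := by
    intro x y a
    refine key _ _ _ ((h.equiv ((x : L) * ((h.equiv ((y : L) * a)).1 : L))).2 *
      (h.equiv ((y : L) * a)).2 : G) ?_
    have e1 := spec y a
    have e2 := spec x (h.equiv ((y : L) * a)).1
    rw [Subgroup.coe_mul, Subgroup.coe_mul, mul_assoc, e1, ← mul_assoc, e2, mul_assoc]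
    simp only [← e1]
  have mul_right : ∀ (x : G) (a b : F), h.equiv ((x : L) * ((a * b : F) : L)) =
      ((h.equiv ((x : L) * a)).1 * (h.equiv (((h.equiv ((x : L) * a)).2 : L) * b)).1,
        (h.equiv (((h.equiv ((x : L) * a)).2 : L) * b)).2) := by
    intro x a b
    refine key _ _ ((h.equiv ((x : L) * a)).1 *
      (h.equiv (((h.equiv ((x : L) * a)).2 : L) * b)).1 : F) _ ?_
    have e1 := spec x a
    have e2 := spec (h.equiv ((x : L) * a)).2 b
    rw [Subgroup.coe_mul, Subgroup.coe_mul, ← mul_assoc, e1, mul_assoc, e2, ← mul_assoc]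
    simp only [← e1]
  { lact := fun x b => (h.equiv ((x : L) * b)).1
    ract := fun x b => (h.equiv ((x : L) * b)).2
    one_lact := fun a => by rw [one_left]
    mul_lact := fun x y a => by rw [mul_left]
    ract_one := fun x => by rw [one_right]
    ract_mul := fun x a b => by rw [mul_right]
    lact_mul := fun x a b => by rw [mul_right]
    mul_ract := fun x y a => by rw [mul_left] }

theorem MatchedPair.ofIsComplement_spec {L : Type*} [Group L] {F G : Subgroup L}
    (h : Subgroup.IsComplement' F G) (x : G) (b : F) :
    (x : L) * b = ((MatchedPair.ofIsComplement h).lact x b : L) *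
      ((MatchedPair.ofIsComplement h).ract x b : L) :=
  (h.equiv_fst_mul_equiv_snd _).symm

/-! ### The bismash product Hopf algebra -/

/-- The bismash product `k^G # kF` of a matched pair, as the `k`-vector space with basis the
elements `p_x # a` for `x ∈ G`, `a ∈ F`. -/
@[nolint unusedArguments]
def Bismash (k : Type*) [Field k] {F G : Type*} [Group F] [Group G] (_P : MatchedPair F G) :
    Type _ :=
  (G × F) →₀ k

namespace Bismash

variable {k : Type*} [Field k] {F G : Type*} [Group F] [Group G] {P : MatchedPair F G}

instance : AddCommGroup (Bismash k P) := inferInstanceAs (AddCommGroup ((G × F) →₀ k))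

instance : Module k (Bismash k P) := inferInstanceAs (Module k ((G × F) →₀ k))

variable (k P) in
/-- The elements `p_x # a` form a basis. -/
def basis : Module.Basis (G × F) k (Bismash k P) :=
  Module.Basis.ofRepr (LinearEquiv.refl k ((G × F) →₀ k))

variable (k P) in
/-- The basis element `p_x # a`. -/
def p (x : G) (a : F) : Bismash k P := basis k P (x, a)

theorem hom_ext {M : Type*} [AddCommMonoid M] [Module k M] {f g : Bismash k P →ₗ[k] M}
    (h : ∀ x a, f (p k P x a) = g (p k P x a)) : f = g :=
  (basis k P).ext fun i => h i.1 i.2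

variable (k P) in
/-- The linear map with prescribed values on the basis `p_x # a`. -/
def lift {M : Type*} [AddCommMonoid M] [Module k M] (f : G → F → M) : Bismash k P →ₗ[k] M :=
  (basis k P).constr ℕ fun i => f i.1 i.2

@[simp] theorem lift_p {M : Type*} [AddCommMonoid M] [Module k M] (f : G → F → M) (x : G)
    (a : F) : lift k P f (p k P x a) = f x a := by
  simp [lift, p]

open scoped Classical in
variable (k P) in
/-- Multiplication: `(p_x # a)(p_y # b) = δ_{y, x ◁ a} p_x # ab`. -/
def mulHom : Bismash k P →ₗ[k] Bismash k P →ₗ[k] Bismash k P :=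
  lift k P fun x a => lift k P fun y b => if y = P.ract x a then p k P x (a * b) else 0

instance : Mul (Bismash k P) := ⟨fun u v => mulHom k P u v⟩

theorem mul_def (u v : Bismash k P) : u * v = mulHom k P u v := rfl

open scoped Classical in
theorem p_mul_p (x y : G) (a b : F) :
    p k P x a * p k P y b = if y = P.ract x a then p k P x (a * b) else 0 := by
  rw [mul_def, mulHom, lift_p, lift_p]

instance : NonUnitalNonAssocRing (Bismash k P) where
  left_distrib u v w := by simp [mul_def]
  right_distrib u v w := by simp [mul_def]
  zero_mul u := by simp [mul_def]
  mul_zero u := by simp [mul_def]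

instance : SMulCommClass k (Bismash k P) (Bismash k P) :=
  ⟨fun c u v => by simp [mul_def]⟩

instance : IsScalarTower k (Bismash k P) (Bismash k P) :=
  ⟨fun c u v => by simp [mul_def]⟩

theorem induction_on {C : Bismash k P → Prop} (u : Bismash k P) (zero : C 0)
    (add : ∀ u v, C u → C v → C (u + v)) (smul : ∀ (c : k) u, C u → C (c • u))
    (basis : ∀ x a, C (p k P x a)) : C u := by
  rw [← (Bismash.basis k P).linearCombination_repr u, Finsupp.linearCombination_apply, Finsupp.sum]
  exact Finset.sum_induction _ C add zero fun i _ => smul _ _ (basis i.1 i.2)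

theorem mul_assoc' (u v w : Bismash k P) : u * v * w = u * (v * w) := by
  classical
  induction u using induction_on with
  | zero => simp
  | add u u' h h' => simp only [add_mul, h, h']
  | smul c u h => simp only [smul_mul_assoc, h]
  | basis x a =>
  induction v using induction_on with
  | zero => simp
  | add u u' h h' => simp only [add_mul, mul_add, h, h']
  | smul c u h => simp only [smul_mul_assoc, mul_smul_comm, h]
  | basis y b =>
  induction w using induction_on with
  | zero => simp
  | add u u' h h' => simp only [mul_add, h, h']
  | smul c u h => simp only [mul_smul_comm, h]
  | basis z c =>
  rw [p_mul_p, p_mul_p]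
  by_cases h : y = P.ract x a
  · subst h
    by_cases h' : z = P.ract (P.ract x a) b
    · subst h'
      simp [p_mul_p, P.ract_mul, mul_assoc]
    · simp [p_mul_p, P.ract_mul, h']
  · by_cases h' : z = P.ract y b <;> simp [h, h', p_mul_p]

open scoped Classical in
variable (k P) in
/-- Counit: `ε(p_x # a) = δ_{x, 1}`. -/
def counitHom : Bismash k P →ₗ[k] k :=
  lift k P fun x _ => if x = 1 then 1 else 0

open scoped Classical in
theorem counitHom_p (x : G) (a : F) :
    counitHom k P (p k P x a) = if x = 1 then 1 else 0 := by
  simp [counitHom]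

variable (k P) in
/-- Antipode: `S(p_x # a) = p_{(x ◁ a)⁻¹} # (x ▷ a)⁻¹`. -/
def antipodeHom : Bismash k P →ₗ[k] Bismash k P :=
  lift k P fun x a => p k P (P.ract x a)⁻¹ (P.lact x a)⁻¹

theorem antipodeHom_p (x : G) (a : F) :
    antipodeHom k P (p k P x a) = p k P (P.ract x a)⁻¹ (P.lact x a)⁻¹ := by
  simp [antipodeHom]

variable [Fintype G]

/-- The unit `1 # 1 = ∑_x p_x # 1`. -/
instance : One (Bismash k P) := ⟨∑ x : G, p k P x 1⟩

theorem one_def : (1 : Bismash k P) = ∑ x : G, p k P x 1 := rfl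

theorem one_mul' (u : Bismash k P) : 1 * u = u := by
  classical
  induction u using induction_on with
  | zero => simp
  | add u u' h h' => simp only [mul_add, h, h']
  | smul c u h => simp only [mul_smul_comm, h]
  | basis x a => simp [one_def, Finset.sum_mul, p_mul_p, P.ract_one]

theorem mul_one' (u : Bismash k P) : u * 1 = u := by
  classical
  induction u using induction_on with
  | zero => simp
  | add u u' h h' => simp only [add_mul, h, h']
  | smul c u h => simp only [smul_mul_assoc, h]
  | basis x a => simp [one_def, Finset.mul_sum, p_mul_p]

instance : Ring (Bismash k P) :=
  { (inferInstance : NonUnitalNonAssocRing (Bismash k P)) with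
    mul_assoc := mul_assoc'
    one := 1
    one_mul := one_mul'
    mul_one := mul_one' }

instance : Algebra k (Bismash k P) :=
  Algebra.ofModule (fun c u v => smul_mul_assoc c u v) (fun c u v => mul_smul_comm c u v)

variable (k P) in
/-- Comultiplication: `Δ(p_x # a) = ∑_y (p_{x y⁻¹} # (y ▷ a)) ⊗ (p_y # a)`. -/
def comulHom : Bismash k P →ₗ[k] Bismash k P ⊗[k] Bismash k P :=
  lift k P fun x a => ∑ y : G, p k P (x * y⁻¹) (P.lact y a) ⊗ₜ[k] p k P y a

theorem comulHom_p (x : G) (a : F) : comulHom k P (p k P x a) =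
    ∑ y : G, p k P (x * y⁻¹) (P.lact y a) ⊗ₜ[k] p k P y a := by
  simp [comulHom]

instance : Coalgebra k (Bismash k P) where
  comul := comulHom k P
  counit := counitHom k P
  coassoc := by
    refine hom_ext fun x a => ?_
    simp only [LinearMap.comp_apply, comulHom_p, map_sum, LinearMap.rTensor_tmul,
      LinearMap.lTensor_tmul, TensorProduct.sum_tmul, TensorProduct.tmul_sum,
      LinearEquiv.coe_coe, TensorProduct.assoc_tmul]
    conv_rhs => rw [Finset.sum_comm]
    refine Finset.sum_congr rfl fun w _ => ?_
    refine Fintype.sum_equiv (Equiv.mulRight w) _ _ fun u => ?_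
    simp [P.mul_lact, mul_assoc]
  rTensor_counit_comp_comul := by
    classical
    refine hom_ext fun x a => ?_
    simp only [LinearMap.comp_apply, comulHom_p, map_sum, LinearMap.rTensor_tmul, counitHom_p,
      mul_inv_eq_one, TensorProduct.mk_apply]
    rw [Finset.sum_eq_single x]
    · simp
    · intro y _ h
      simp [h.symm]
    · simp
  lTensor_counit_comp_comul := by
    classical
    refine hom_ext fun x a => ?_
    simp only [LinearMap.comp_apply, comulHom_p, map_sum, LinearMap.lTensor_tmul, counitHom_p,
      LinearMap.flip_apply, TensorProduct.mk_apply]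
    rw [Finset.sum_eq_single 1]
    · simp [P.one_lact]
    · intro y _ h
      simp [h]
    · simp

theorem comul_p (x : G) (a : F) : Coalgebra.comul (R := k) (p k P x a) =
    ∑ y : G, p k P (x * y⁻¹) (P.lact y a) ⊗ₜ[k] p k P y a :=
  comulHom_p x a

open scoped Classical in
theorem counit_p (x : G) (a : F) :
    Coalgebra.counit (R := k) (p k P x a) = if x = 1 then 1 else 0 :=
  counitHom_p x a

theorem counit_mul' (u v : Bismash k P) : Coalgebra.counit (R := k) (u * v) =
    Coalgebra.counit (R := k) u * Coalgebra.counit (R := k) v := by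
  classical
  induction u using induction_on with
  | zero => simp
  | add u u' h h' => simp only [add_mul, map_add, h, h']
  | smul c u h => simp only [smul_mul_assoc, map_smul, h]
  | basis x a =>
  induction v using induction_on with
  | zero => simp
  | add u u' h h' => simp only [mul_add, map_add, h, h']
  | smul c u h => simp only [mul_smul_comm, map_smul, h]
  | basis y b =>
  rw [p_mul_p, counit_p, counit_p]
  by_cases hx : x = 1
  · subst hx
    by_cases hy : y = 1 <;> simp [hy, P.one_ract, counit_p]
  · by_cases hy : y = P.ract x a <;> simp [hx, hy, counit_p]

theorem comul_mul' (u v : Bismash k P) : Coalgebra.comul (R := k) (u * v) =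
    Coalgebra.comul (R := k) u * Coalgebra.comul (R := k) v := by
  classical
  induction u using induction_on with
  | zero => simp
  | add u u' h h' => simp only [add_mul, map_add, h, h']
  | smul c u h => simp only [smul_mul_assoc, map_smul, h]
  | basis x a =>
  induction v using induction_on with
  | zero => simp
  | add u u' h h' => simp only [mul_add, map_add, h, h']
  | smul c u h => simp only [mul_smul_comm, map_smul, h]
  | basis y b =>
  rw [p_mul_p, comul_p, comul_p, Finset.sum_mul_sum]
  simp only [Algebra.TensorProduct.tmul_mul_tmul, p_mul_p]
  have key : ∀ z : G, ∑ w : G,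
      (if y * w⁻¹ = P.ract (x * z⁻¹) (P.lact z a) then
        p k P (x * z⁻¹) (P.lact z a * P.lact w b) else 0) ⊗ₜ[k]
          (if w = P.ract z a then p k P z (a * b) else 0) =
      if y = P.ract x a then
        p k P (x * z⁻¹) (P.lact z (a * b)) ⊗ₜ[k] p k P z (a * b) else 0 := by
    intro z
    rw [Finset.sum_eq_single (P.ract z a)]
    · rw [P.ract_mul_inv, mul_left_inj, P.lact_mul]
      by_cases h : y = P.ract x a <;> simp [h]
    · intro w _ h
      simp [h]
    · simp
  rw [Finset.sum_congr rfl fun z _ => key z]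
  by_cases h : y = P.ract x a <;> simp [h, comul_p]

theorem counit_one' : Coalgebra.counit (R := k) (1 : Bismash k P) = 1 := by
  classical
  simp [one_def, counit_p]

theorem comul_one' : Coalgebra.comul (R := k) (1 : Bismash k P) = 1 := by
  rw [one_def, map_sum, Algebra.TensorProduct.one_def, one_def]
  simp only [comul_p, P.lact_one, TensorProduct.sum_tmul, TensorProduct.tmul_sum]
  rw [Finset.sum_comm]
  conv_rhs => rw [Finset.sum_comm]
  conv_rhs => rw [Finset.sum_comm]
  refine Finset.sum_congr rfl fun w _ => ?_
  exact Fintype.sum_equiv (Equiv.mulRight w⁻¹) _ _ fun u => rfl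

instance : Bialgebra k (Bismash k P) :=
  Bialgebra.mk' k (Bismash k P) counit_one' (fun {u v} => counit_mul' u v) comul_one'
    (fun {u v} => comul_mul' u v)

/-- The bismash product `k^G # kF` as a Hopf algebra. -/
instance : HopfAlgebra k (Bismash k P) where
  antipode := antipodeHom k P
  mul_antipode_rTensor_comul := by
    classical
    refine hom_ext fun x a => ?_
    simp only [LinearMap.comp_apply, comul_p, counit_p, map_sum, LinearMap.rTensor_tmul,
      antipodeHom_p, LinearMap.mul'_apply, P.ract_mul_inv, P.lact_mul_inv, p_mul_p,
      Algebra.linearMap_apply]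
    have key : ∀ y : G,
        (y = P.ract (P.ract x a * (P.ract y a)⁻¹)⁻¹ (P.lact x a)⁻¹) ↔ x = 1 := by
      intro y
      rw [← (P.ract_injective (P.lact x a)).eq_iff]
      simp only [← P.ract_mul, inv_mul_cancel, P.ract_one, mul_inv_rev, inv_inv]
      rw [eq_mul_inv_iff_mul_eq, ← P.mul_ract, (P.ract_injective a).eq_iff]
      simp
    simp only [key]
    by_cases hx : x = 1
    · subst hx
      simp only [if_true, map_one, P.one_lact, P.one_ract, one_mul, inv_inv, inv_mul_cancel,
        one_def]
      exact Fintype.sum_bijective (fun y => P.ract y a) ⟨P.ract_injective a, P.ract_surjective a⟩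
        _ _ fun y => rfl
    · simp [hx]
  mul_antipode_lTensor_comul := by
    classical
    refine hom_ext fun x a => ?_
    simp only [LinearMap.comp_apply, comul_p, counit_p, map_sum, LinearMap.lTensor_tmul,
      antipodeHom_p, LinearMap.mul'_apply, P.ract_mul_inv, p_mul_p, Algebra.linearMap_apply]
    have key : ∀ y : G, ((P.ract y a)⁻¹ = P.ract x a * (P.ract y a)⁻¹) ↔ x = 1 := by
      intro y
      rw [right_eq_mul]
      exact ⟨fun h => P.ract_injective a (h.trans (P.one_ract a).symm),
        fun h => h ▸ P.one_ract a⟩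
    simp only [key]
    by_cases hx : x = 1
    · subst hx
      simp only [if_true, map_one, one_mul, mul_inv_cancel, one_def]
      exact Fintype.sum_equiv (Equiv.inv G) _ _ fun u => rfl
    · simp [hx]

end Bismash

/-! ### Integrals, irreducible representations and Frobenius–Schur indicators -/

section Indicator

universe u

/-- `Λ` is a two-sided integral, `hΛ = ε(h)Λ = Λh`, normalized by `ε(Λ) = 1`. -/
def IsNormalizedIntegral (k : Type*) {H : Type*} [Field k] [Ring H] [HopfAlgebra k H] (Λ : H) :
    Prop :=
  (∀ h : H, h * Λ = Coalgebra.counit (R := k) h • Λ ∧ Λ * h = Coalgebra.counit (R := k) h • Λ) ∧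
    Coalgebra.counit (R := k) Λ = 1

theorem IsNormalizedIntegral.unique {k H : Type*} [Field k] [Ring H] [HopfAlgebra k H]
    {Λ Λ' : H} (h : IsNormalizedIntegral k Λ) (h' : IsNormalizedIntegral k Λ') : Λ = Λ' := by
  have e := (h.1 Λ').2
  rw [(h'.1 Λ).1, h.2, h'.2, one_smul, one_smul] at e
  exact e.symm

open scoped Classical in
/-- The normalized two-sided integral of a Hopf algebra that has one (for instance a
finite-dimensional semisimple one); `0` otherwise. -/
def normalizedIntegral (k H : Type*) [Field k] [Ring H] [HopfAlgebra k H] : H :=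
  if h : ∃ Λ : H, IsNormalizedIntegral k Λ then h.choose else 0

theorem IsNormalizedIntegral.eq {k H : Type*} [Field k] [Ring H] [HopfAlgebra k H]
    {Λ : H} (h : IsNormalizedIntegral k Λ) : normalizedIntegral k H = Λ := by
  have hex : ∃ Λ : H, IsNormalizedIntegral k Λ := ⟨Λ, h⟩
  rw [normalizedIntegral, dif_pos hex]
  exact hex.choose_spec.unique h

/-- In the bismash product the normalized integral exists: it is `|F|⁻¹ ∑_a p_1 # a`. -/
theorem Bismash.isNormalizedIntegral {k : Type*} [Field k] [CharZero k] {F G : Type*} [Group F]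
    [Group G] [Fintype F] [Fintype G] (P : MatchedPair F G) :
    IsNormalizedIntegral k ((Fintype.card F : k)⁻¹ • ∑ a : F, Bismash.p k P 1 a) := by
  classical
  have hF : (Fintype.card F : k) ≠ 0 := Nat.cast_ne_zero.mpr Fintype.card_ne_zero
  refine ⟨fun h => ?_, ?_⟩
  · rw [mul_smul_comm, smul_mul_assoc, smul_comm _ (_ : k)⁻¹]
    suffices hh : h * ∑ a : F, Bismash.p k P 1 a =
          Coalgebra.counit (R := k) h • ∑ a : F, Bismash.p k P 1 a ∧
        (∑ a : F, Bismash.p k P 1 a) * h =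
          Coalgebra.counit (R := k) h • ∑ a : F, Bismash.p k P 1 a by
      rw [hh.1, hh.2]
      exact ⟨rfl, rfl⟩
    induction h using Bismash.induction_on with
    | zero => simp
    | add u u' h h' => simp only [add_mul, mul_add, map_add, add_smul, h, h', and_self]
    | smul c u h => simp only [smul_mul_assoc, mul_smul_comm, map_smul, smul_assoc, h, and_self]
    | basis x b =>
    have key : (1 = P.ract x b) ↔ x = 1 :=
      ⟨fun h => P.ract_injective b (h.symm.trans (P.one_ract b).symm),
        fun h => h ▸ (P.one_ract b).symm⟩
    simp only [Finset.mul_sum, Finset.sum_mul, Bismash.p_mul_p, Bismash.counit_p, P.one_ract, key]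
    by_cases hx : x = 1
    · subst hx
      simp only [if_true, one_smul]
      exact ⟨Fintype.sum_equiv (Equiv.mulLeft b) _ _ fun _ => rfl,
        Fintype.sum_equiv (Equiv.mulRight b) _ _ fun _ => rfl⟩
    · simp [hx]
  · simp [Bismash.counit_p, hF]

/-- A `d`-dimensional irreducible representation of the `k`-algebra `H`: a simple `H`-module of
`k`-dimension `d`. -/
structure Irrep (k H : Type u) [Field k] [Ring H] [Algebra k H] (d : ℕ) where
  V : Type u
  [addCommGroup : AddCommGroup V]
  [moduleBase : Module k V]
  [module : Module H V]
  [isScalarTower : IsScalarTower k H V]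
  [finite : Module.Finite k V]
  [simple : IsSimpleModule H V]
  finrank_eq : Module.finrank k V = d

attribute [instance] Irrep.addCommGroup Irrep.moduleBase Irrep.module Irrep.isScalarTower
  Irrep.finite Irrep.simple

/-- Two irreps are equivalent if they are isomorphic as `H`-modules. -/
instance Irrep.setoid (k H : Type u) [Field k] [Ring H] [Algebra k H] (d : ℕ) :
    Setoid (Irrep k H d) where
  r A B := Nonempty (A.V ≃ₗ[H] B.V)
  iseqv :=
    { refl := fun A => ⟨LinearEquiv.refl H A.V⟩
      symm := fun ⟨e⟩ => ⟨e.symm⟩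
      trans := fun ⟨e⟩ ⟨f⟩ => ⟨e.trans f⟩ }

/-- The type of isomorphism classes of `d`-dimensional irreps of `H`. -/
def IrrepClass (k H : Type u) [Field k] [Ring H] [Algebra k H] (d : ℕ) : Type (u + 1) :=
  Quotient (Irrep.setoid k H d)

/-- The character `χ(h) = Tr(h | V)` of an irrep. -/
def Irrep.character {k H : Type u} [Field k] [Ring H] [Algebra k H] {d : ℕ} (A : Irrep k H d)
    (h : H) : k :=
  LinearMap.trace k A.V (Algebra.lsmul k k A.V h)

theorem Irrep.character_congr {k H : Type u} [Field k] [Ring H] [Algebra k H] {d : ℕ}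
    {A B : Irrep k H d} (e : A.V ≃ₗ[H] B.V) (h : H) : A.character h = B.character h := by
  rw [Irrep.character, Irrep.character,
    ← LinearMap.trace_conj' (Algebra.lsmul k k A.V h) (e.restrictScalars k)]
  congr 1
  ext v
  simp [LinearEquiv.conj_apply]

/-- The Frobenius–Schur indicator `ν(χ) = χ(∑ Λ₁ Λ₂) = χ((m ∘ Δ)(Λ))`. -/
def Irrep.indicator {k H : Type u} [Field k] [Ring H] [HopfAlgebra k H] {d : ℕ}
    (A : Irrep k H d) : k :=
  A.character (LinearMap.mul' k H (Coalgebra.comul (R := k) (normalizedIntegral k H)))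

/-- The indicator of an isomorphism class of irreps. -/
def IrrepClass.indicator {k H : Type u} [Field k] [Ring H] [HopfAlgebra k H] {d : ℕ}
    (q : IrrepClass k H d) : k :=
  Quotient.lift (s := Irrep.setoid k H d) (fun A : Irrep k H d => A.indicator)
    (fun A B (h : Nonempty (A.V ≃ₗ[H] B.V)) => Irrep.character_congr h.some _) q

end Indicator

/-! ### The Hopf algebra `J_n` -/

section Jn

variable (n : ℕ)

/-- The standard `n`-cycle `i ↦ i + 1`, with `{1, …, n}` identified with `ℤ/nℤ`. -/
def stdCycle : Equiv.Perm (ZMod n) := Equiv.addRight 1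

/-- The cyclic group `C_n ⊆ S_n` generated by the standard `n`-cycle. -/
abbrev cyclicSubgroup : Subgroup (Equiv.Perm (ZMod n)) := Subgroup.zpowers (stdCycle n)

/-- `S_{n-1} ⊆ S_n`, the permutations that fix the point `n` (the class `0` in `ℤ/nℤ`). -/
abbrev pointSubgroup : Subgroup (Equiv.Perm (ZMod n)) :=
  MulAction.stabilizer (Equiv.Perm (ZMod n)) (0 : ZMod n)

theorem stdCycle_zpow_apply (r : ℤ) (i : ZMod n) : (stdCycle n ^ r) i = i + r := by
  simp [stdCycle]

/-- `S_n = C_n S_{n-1}` with `C_n ∩ S_{n-1} = 1`. -/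
theorem isComplement_cyclic_point :
    Subgroup.IsComplement' (cyclicSubgroup n) (pointSubgroup n) := by
  refine Subgroup.isComplement'_stabilizer (0 : ZMod n) ?_ ?_
  · rintro ⟨_, r, rfl⟩ h
    have h' : (stdCycle n ^ r) (0 : ZMod n) = 0 := h
    rw [stdCycle_zpow_apply, zero_add] at h'
    ext i : 2
    change (stdCycle n ^ r) i = i
    rw [stdCycle_zpow_apply, h', add_zero]
  · intro g
    obtain ⟨r, hr⟩ := ZMod.intCast_surjective (g 0)
    refine ⟨⟨stdCycle n ^ (-r), -r, rfl⟩, ?_⟩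
    change (stdCycle n ^ (-r)) (g 0) = 0
    rw [stdCycle_zpow_apply, ← hr]
    simp

variable [NeZero n]

instance : Fintype (cyclicSubgroup n) := Fintype.ofFinite _

instance : Fintype (pointSubgroup n) := Fintype.ofFinite _

/-- The matched pair `(C_n, S_{n-1}, ▷, ◁)` given by the factorization of `S_n`. -/
def matchedPairSn : MatchedPair (cyclicSubgroup n) (pointSubgroup n) :=
  MatchedPair.ofIsComplement (isComplement_cyclic_point n)

/-- The Hopf algebra `J_n = k^{S_{n-1}} # kC_n`. -/
abbrev BismashJ (k : Type*) [Field k] : Type _ := Bismash k (matchedPairSn n)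

end Jn

end

/-! The elements `p_x # 1` are orthogonal idempotents that a module is graded by, and `u b = 1 # b`
carries the component of `x ◁ b` to that of `x`. Hence a simple module is supported on one orbit of
`C_n` on `S_{n-1}`. With `g` the `n`-cycle and `n = 2m`, the 2-dimensional ones are given by an
orbit `{x, x ◁ g}` of size two together with a scalar `ζ`, `ζ ^ m = 1`, by which `g ^ 2` acts
(`Bismash.exists_orbitIrrep`, `Bismash.orbitIrrep_equiv`). So their number is half the number of
points in such orbits, times the number of `m`-th roots of unity.

Expanding the indicator over the integral, every term vanishes unless some `z` in the orbit
satisfies `z⁻¹ ◁ b = z` (`Bismash.exists_inv_of_indicator_ne_zero`). On `ℤ/2m` the action is `(x ◁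
b)(i) = x(i + b 0) - x(b 0)`, so `x ◁ g² = x` means `x(i + 2) = x(i) + x(2)`. For such `x` the
inversion condition forces `x(x 2) = 2` (`apply_apply_two_of_inv`). Only this necessary condition is
needed, since an upper bound on the numerator suffices.

Units `v` of `ℤ/2m` act on these points by `x ↦ v x`. If `x` and `v x` both satisfy the condition,
then `2v² = 2`. Translating by representatives of the cosets of `{v | 2v² = 2}` therefore shows that
the points with `x(x 2) = 2` make up at most the fraction `1 / index` of all points
(`card_selfInverse_mul_index_le`), and the ratio of irreps is at most `2 / index`. The index tends
to infinity because `m ≤ 36 ^ index` (`le_pow_index_twoSqSubgroup`). -/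

noncomputable section

/-! ### Generators of the bismash product and algebra maps out of it. -/

namespace Bismash

variable {k : Type*} [Field k] {F G : Type*} [Group F] [Group G] {P : MatchedPair F G}

open scoped Classical in
/-- An algebra map out of `k^G # kF` is given by a complete family of orthogonal idempotents
indexed by `G` and a representation of `F` permuting it. -/
def liftAlgHom [Fintype G] {A : Type*} [Ring A] [Algebra k A] (E : G → A) (B : F →* A)
    (hE : ∀ x y, E x * E y = if y = x then E x else 0) (hsum : ∑ x, E x = 1)
    (hEB : ∀ x b, E x * B b = B b * E (P.ract x b)) : Bismash k P →ₐ[k] A :=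
  AlgHom.ofLinearMap (lift k P fun x b => E x * B b)
    (by simp [one_def, hsum])
    (by
      intro u v
      induction u using induction_on with
      | zero => simp
      | add u u' h h' => simp only [add_mul, map_add, h, h']
      | smul c u h => simp only [smul_mul_assoc, map_smul, h]
      | basis x a =>
      induction v using induction_on with
      | zero => simp
      | add u u' h h' => simp only [mul_add, map_add, h, h']
      | smul c u h => simp only [mul_smul_comm, map_smul, h]
      | basis y b =>
      rw [p_mul_p, lift_p, lift_p, ← mul_assoc, hEB, mul_assoc (B a), hE]
      split_ifs with h
      · rw [lift_p, map_mul, ← mul_assoc, hEB]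
      · simp)

open scoped Classical in
@[simp] theorem liftAlgHom_p [Fintype G] {A : Type*} [Ring A] [Algebra k A] (E : G → A)
    (B : F →* A) (hE : ∀ x y, E x * E y = if y = x then E x else 0) (hsum : ∑ x, E x = 1)
    (hEB : ∀ x b, E x * B b = B b * E (P.ract x b)) (x : G) (b : F) :
    liftAlgHom (k := k) E B hE hsum hEB (p k P x b) = E x * B b := by
  rw [liftAlgHom, AlgHom.ofLinearMap_apply, lift_p]

variable [Fintype G]

variable (k P) in
/-- The element `1 # b = ∑_x p_x # b`. -/
def u (b : F) : Bismash k P := ∑ x : G, p k P x b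

theorem p_one_mul_u (x : G) (b : F) : p k P x 1 * u k P b = p k P x b := by
  classical
  simp [u, Finset.mul_sum, p_mul_p, P.ract_one]

theorem u_mul_p_one (x : G) (b : F) : u k P b * p k P (P.ract x b) 1 = p k P x b := by
  classical
  simp [u, Finset.sum_mul, p_mul_p, (P.ract_injective b).eq_iff]

/-- This is the rule by which `u b` maps the `x ◁ b` component of a module into the `x` component.
-/
theorem p_one_mul_u_comm (x : G) (b : F) :
    p k P x 1 * u k P b = u k P b * p k P (P.ract x b) 1 := by
  rw [p_one_mul_u, u_mul_p_one]

open scoped Classical in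
theorem p_one_mul_p_one (x y : G) :
    p k P x 1 * p k P y 1 = if y = x then p k P x 1 else 0 := by
  simp [p_mul_p, P.ract_one]

theorem u_one : u k P 1 = 1 := rfl

theorem u_mul (b c : F) : u k P (b * c) = u k P b * u k P c := by
  classical
  rw [u, u, Finset.sum_mul]
  refine Finset.sum_congr rfl fun x _ => ?_
  simp [u, Finset.mul_sum, p_mul_p]

theorem u_pow (b : F) (r : ℕ) : u k P (b ^ r) = u k P b ^ r := by
  induction r with
  | zero => simp [u_one]
  | succ r ih => rw [pow_succ, u_mul, ih, pow_succ]

/-- Induction on generators, if `g` generates `F`. -/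
theorem induction_gen [Finite F] {g : F} (hg : ∀ b : F, b ∈ Subgroup.zpowers g)
    {C : Bismash k P → Prop} (h : Bismash k P) (zero : C 0) (one : C 1)
    (add : ∀ u v, C u → C v → C (u + v)) (smul : ∀ (c : k) u, C u → C (c • u))
    (mul : ∀ u v, C u → C v → C (u * v)) (hp : ∀ x, C (p k P x 1)) (hu : C (u k P g)) :
    C h := by
  induction h using induction_on with
  | zero => exact zero
  | add u v hu hv => exact add u v hu hv
  | smul c u hu => exact smul c u hu
  | basis x b =>
    obtain ⟨r, rfl⟩ := mem_powers_iff_mem_zpowers.mpr (hg b)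
    change C (p k P x (g ^ r))
    rw [← p_one_mul_u, u_pow]
    refine mul _ _ (hp x) ?_
    induction r with
    | zero => simpa using one
    | succ r ih => rw [pow_succ]; exact mul _ _ ih hu

end Bismash

/-! ### Irreps from irreducible algebra maps. -/

section Irrep

universe u

/-- The irrep given by an irreducible algebra map to `End V`. -/
def Irrep.ofAlgHom {k H : Type u} [Field k] [Ring H] [Algebra k H] {V : Type u}
    [AddCommGroup V] [Module k V] [Module.Finite k V] [Nontrivial V] {d : ℕ}
    (ρ : H →ₐ[k] Module.End k V)
    (hs : ∀ W : Submodule k V, (∀ h, ∀ w ∈ W, ρ h w ∈ W) → W = ⊥ ∨ W = ⊤)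
    (hd : Module.finrank k V = d) : Irrep k H d :=
  letI : Module H V := Module.compHom V (ρ : H →+* Module.End k V)
  haveI : IsScalarTower k H V := ⟨fun c h v => by
    change ρ (c • h) v = c • ρ h v
    rw [map_smul]
    rfl⟩
  { V := V
    simple :=
      { exists_pair_ne := ⟨⊥, ⊤, bot_ne_top⟩
        eq_bot_or_eq_top := fun W => by
          rcases hs (W.restrictScalars k) (fun h w hw => W.smul_mem h hw) with h | h
          · exact Or.inl ((Submodule.restrictScalars_eq_bot_iff _ _ _).mp h)
          · exact Or.inr ((Submodule.restrictScalars_eq_top_iff _ _ _).mp h) }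
    finrank_eq := hd }

theorem Irrep.character_ofAlgHom {k H : Type u} [Field k] [Ring H] [Algebra k H] {V : Type u}
    [AddCommGroup V] [Module k V] [Module.Finite k V] [Nontrivial V] {d : ℕ}
    (ρ : H →ₐ[k] Module.End k V)
    (hs : ∀ W : Submodule k V, (∀ h, ∀ w ∈ W, ρ h w ∈ W) → W = ⊥ ∨ W = ⊤)
    (hd : Module.finrank k V = d) (h : H) :
    (Irrep.ofAlgHom ρ hs hd).character h = LinearMap.trace k V (ρ h) := rfl

end Irrep

/-! ### The 2 × 2 matrix representation of an orbit of size two. -/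

namespace Bismash

variable {k : Type*} [Field k] {F G : Type*} [Group F] [Group G] [Fintype G]
  {P : MatchedPair F G} {g : F} {m : ℕ}

/-- The matrix `(0 ζ; 1 0)`, as a unit of order dividing `2m`. -/
theorem swapMatrix_pow {ζ : k} (hζ : ζ ^ m = 1) :
    (!![0, ζ; 1, 0] : Matrix (Fin 2) (Fin 2) k) ^ (2 * m) = 1 := by
  have h : (!![0, ζ; 1, 0] : Matrix (Fin 2) (Fin 2) k) ^ 2 = ζ • 1 := by
    ext i j
    fin_cases i <;> fin_cases j <;> simp [pow_two]
  rw [pow_mul, h, smul_pow, hζ, one_pow, one_smul]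

/-- The representation `g ↦ (0 ζ; 1 0)` of a cyclic group of order `2m`. -/
def swapHom (hg : ∀ b : F, b ∈ Subgroup.zpowers g) (hm : orderOf g = 2 * m) [NeZero m] {ζ : k}
    (hζ : ζ ^ m = 1) : F →* Matrix (Fin 2) (Fin 2) k :=
  (Units.coeHom _).comp (monoidHomOfForallMemZpowers hg
    (g' := Units.ofPowEqOne _ (2 * m) (swapMatrix_pow hζ) (NeZero.ne _))
    (by rw [hm]; exact orderOf_dvd_of_pow_eq_one (Units.pow_ofPowEqOne _ _)))

theorem swapHom_gen (hg : ∀ b : F, b ∈ Subgroup.zpowers g) (hm : orderOf g = 2 * m) [NeZero m]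
    {ζ : k} (hζ : ζ ^ m = 1) : swapHom hg hm hζ g = !![0, ζ; 1, 0] := by
  simp [swapHom, monoidHomOfForallMemZpowers_apply_gen]

open scoped Classical in
/-- The projections on the coordinates `x`, `y` of `k²`. -/
def coordProj (k : Type*) [Field k] (x y z : G) : Matrix (Fin 2) (Fin 2) k :=
  Matrix.diagonal ![if z = x then 1 else 0, if z = y then 1 else 0]

open scoped Classical in
/-- The matrix representation attached to an orbit `{x, x ◁ g}` and a character of the
stabilizer. -/
def orbitMatrixRep [Finite F] (hg : ∀ b : F, b ∈ Subgroup.zpowers g) (hm : orderOf g = 2 * m)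
    [NeZero m] {ζ : k} (hζ : ζ ^ m = 1) {x : G}
    (hx : P.ract (P.ract x g) g = x) : Bismash k P →ₐ[k] Matrix (Fin 2) (Fin 2) k :=
  liftAlgHom (coordProj k x (P.ract x g)) (swapHom hg hm hζ)
    (by
      intro y z
      rw [coordProj, coordProj, Matrix.diagonal_mul_diagonal]
      ext i j
      fin_cases i <;> fin_cases j <;> by_cases h : z = y <;> simp [h] <;> grind)
    (by
      have h : ∀ y : G, ∑ z, (if z = y then 1 else 0 : k) = 1 := fun y =>
        (Finset.sum_ite_eq' _ y _).trans (if_pos (Finset.mem_univ y))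
      ext i j
      rw [Matrix.sum_apply]
      fin_cases i <;> fin_cases j <;> simp [coordProj, -Finset.sum_boole, h])
    (by
      -- Both `◁ g` on `{x, x ◁ g}` and the matrix of `g` on the coordinate lines are the swap. The
      -- relation for powers of `g` follows by induction.
      have h0 : ∀ z, coordProj k x (P.ract x g) z * swapHom hg hm hζ g =
          swapHom hg hm hζ g * coordProj k x (P.ract x g) (P.ract z g) := by
        intro z
        have e1 : P.ract z g = P.ract x g ↔ z = x := (P.ract_injective g).eq_iff
        have e2 : P.ract z g = x ↔ z = P.ract x g := by
          conv_lhs => rw [← hx]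
          exact (P.ract_injective g).eq_iff
        rw [swapHom_gen, coordProj, coordProj]
        simp only [e1, e2]
        ext i j
        fin_cases i <;> fin_cases j <;> simp [Matrix.mul_apply]
      intro z b
      obtain ⟨r, rfl⟩ := mem_powers_iff_mem_zpowers.mpr (hg b)
      change _ * swapHom hg hm hζ (g ^ r) =
        swapHom hg hm hζ (g ^ r) * coordProj _ _ _ (P.ract z (g ^ r))
      induction r with
      | zero => simp [P.ract_one]
      | succ r ih =>
        rw [pow_succ, map_mul, ← mul_assoc, ih, mul_assoc, h0, P.ract_mul, mul_assoc])

end Bismash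

/-! ### Modules graded by `G`. -/

namespace Bismash

universe u

section Modules

variable {k : Type*} [Field k] {F G : Type*} [Group F] [Group G] [Fintype G]
  {P : MatchedPair F G} {g : F}

variable {V W : Type*} [AddCommGroup V] [Module k V] [Module (Bismash k P) V]
  [IsScalarTower k (Bismash k P) V] [AddCommGroup W] [Module k W] [Module (Bismash k P) W]
  [IsScalarTower k (Bismash k P) W]

theorem smul_mem_of_gen [Finite F] (hg : ∀ b : F, b ∈ Subgroup.zpowers g) {U : Submodule k V}
    (hp : ∀ z, ∀ w ∈ U, p k P z 1 • w ∈ U) (hu : ∀ w ∈ U, u k P g • w ∈ U) (h : Bismash k P) :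
    ∀ w ∈ U, h • w ∈ U := by
  induction h using induction_gen (k := k) (P := P) hg with
  | zero => simp
  | one => simp
  | add a b ha hb => intro w hw; rw [add_smul]; exact U.add_mem (ha w hw) (hb w hw)
  | smul c a ha => intro w hw; rw [smul_assoc]; exact U.smul_mem c (ha w hw)
  | mul a b ha hb => intro w hw; rw [mul_smul]; exact ha _ (hb w hw)
  | hp z => exact hp z
  | hu => exact hu

theorem eq_top_of_gen [Finite F] [IsSimpleModule (Bismash k P) V]
    (hg : ∀ b : F, b ∈ Subgroup.zpowers g) {U : Submodule k V}
    (hp : ∀ z, ∀ w ∈ U, p k P z 1 • w ∈ U) (hu : ∀ w ∈ U, u k P g • w ∈ U) (h : U ≠ ⊥) :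
    U = ⊤ := by
  let U' : Submodule (Bismash k P) V :=
    { U with smul_mem' := fun h w hw => smul_mem_of_gen hg hp hu h w hw }
  have hU : U'.restrictScalars k = U := rfl
  rcases eq_bot_or_eq_top U' with h' | h'
  · exact absurd (by rw [← hU, h', Submodule.restrictScalars_bot]) h
  · rw [← hU, h', Submodule.restrictScalars_top]

/-- A `k`-linear map commuting with the generators is a module map. -/
def linearMapOfGen [Finite F] (hg : ∀ b : F, b ∈ Subgroup.zpowers g) (f : V →ₗ[k] W)
    (hp : ∀ z v, f (p k P z 1 • v) = p k P z 1 • f v)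
    (hu : ∀ v, f (u k P g • v) = u k P g • f v) : V →ₗ[Bismash k P] W :=
  { f with
    map_smul' := fun h => by
      change ∀ v, f (h • v) = h • f v
      induction h using induction_gen (k := k) (P := P) hg with
      | zero => simp
      | one => simp
      | add a b ha hb => intro v; simp only [add_smul, map_add, ha, hb]
      | smul c a ha => intro v; simp only [smul_assoc, map_smul, ha]
      | mul a b ha hb => intro v; simp only [mul_smul, ha, hb]
      | hp z => exact hp z
      | hu => exact hu }

omit [Module k V] [IsScalarTower k (Bismash k P) V] in
open scoped Classical in
theorem p_one_smul {x : G} {v : V} (hv : p k P x 1 • v = v) (z : G) :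
    p k P z 1 • v = if z = x then v else 0 := by
  rw [← hv, ← mul_smul, p_one_mul_p_one]
  by_cases h : x = z
  · simp [h]
  · simp [h, Ne.symm h]

omit [Module k V] [IsScalarTower k (Bismash k P) V] in
theorem p_one_smul_u_smul {x : G} {v : V} (hv : p k P x 1 • v = v) {z : G} {b : F}
    (h : P.ract z b = x) : p k P z 1 • u k P b • v = u k P b • v := by
  rw [← mul_smul, p_one_mul_u_comm, mul_smul, h, hv]

omit [Module k V] [IsScalarTower k (Bismash k P) V] in
theorem u_smul_ne_zero {v : V} (hv : v ≠ 0) (b : F) : u k P b • v ≠ 0 := by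
  intro h
  apply hv
  rw [← one_smul (Bismash k P) v, ← u_one, ← inv_mul_cancel b, u_mul, mul_smul, h, smul_zero]

/-- When `b` fixes `x`, the operator `u b` preserves the component `p_x V`, so it has an eigenvector
there. -/
theorem exists_eigenvector [IsAlgClosed k] [Module.Finite k V] {x : G} {b : F}
    (hx : P.ract x b = x) {w : V} (hw : p k P x 1 • w ≠ 0) :
    ∃ v : V, v ≠ 0 ∧ p k P x 1 • v = v ∧ ∃ ζ : k, u k P b • v = ζ • v := by
  have hpp : ∀ v : V, p k P x 1 • p k P x 1 • v = p k P x 1 • v := fun v => by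
    rw [← mul_smul, p_one_mul_p_one, if_pos rfl]
  let U : Submodule k V := LinearMap.range (Algebra.lsmul k k V (p k P x 1))
  have hU : ∀ v ∈ U, Algebra.lsmul k k V (u k P b) v ∈ U := by
    rintro _ ⟨v, rfl⟩
    exact ⟨u k P b • p k P x 1 • v, p_one_smul_u_smul (hpp v) hx⟩
  have : Nontrivial U := ⟨⟨⟨_, w, rfl⟩, 0, fun h => hw (congrArg Subtype.val h)⟩⟩
  obtain ⟨ζ, hζ⟩ := Module.End.exists_eigenvalue ((Algebra.lsmul k k V (u k P b)).restrict hU)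
  obtain ⟨⟨_, v, rfl⟩, hv⟩ := hζ.exists_hasEigenvector
  exact ⟨p k P x 1 • v, fun h => hv.2 (Subtype.ext h), hpp v, ζ,
    congrArg Subtype.val hv.apply_eq_smul⟩

/-- Vectors in distinct components are separated by the idempotents. This bounds the size of an
orbit supporting a module by its dimension. -/
theorem linearIndependent_of_p_one_smul {ι : Type*} [Fintype ι] {y : ι → G}
    (hy : Function.Injective y) {v : ι → V} (hv : ∀ i, v i ≠ 0)
    (hp : ∀ i, p k P (y i) 1 • v i = v i) : LinearIndependent k v := by
  classical
  rw [Fintype.linearIndependent_iff]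
  intro c hc i
  have h := congrArg (p k P (y i) 1 • ·) hc
  simp only [Finset.smul_sum, smul_zero, smul_comm (p k P (y i) 1), p_one_smul (hp _),
    hy.eq_iff] at h
  simpa [hv i] using h

end Modules

/-! ### Classification of the 2-dimensional irreps. -/

section OrbitIrrep

variable {k : Type u} [Field k] {F G : Type} [Group F] [Finite F] [Group G] [Fintype G]
  {P : MatchedPair F G} {g : F} {m : ℕ} [NeZero m] (hg : ∀ b : F, b ∈ Subgroup.zpowers g)
  (hm : orderOf g = 2 * m) {ζ : k} (hζ : ζ ^ m = 1) {x : G}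
  (hx : P.ract (P.ract x g) g = x)

theorem orbitMatrixRep_p (z : G) (b : F) : orbitMatrixRep hg hm hζ hx (p k P z b) =
    coordProj k x (P.ract x g) z * swapHom hg hm hζ b :=
  liftAlgHom_p _ _ _ _ _ _ _

theorem orbitMatrixRep_p_one (z : G) : orbitMatrixRep hg hm hζ hx (p k P z 1) =
    coordProj k x (P.ract x g) z := by
  rw [orbitMatrixRep_p, map_one, mul_one]

theorem orbitMatrixRep_u (b : F) : orbitMatrixRep hg hm hζ hx (u k P b) =
    swapHom hg hm hζ b := by
  rw [u, map_sum]
  simp only [orbitMatrixRep_p, ← Finset.sum_mul]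
  simp only [← orbitMatrixRep_p_one hg hm hζ hx]
  rw [← map_sum, ← one_def, map_one, one_mul]

theorem orbitMatrixRep_gen : orbitMatrixRep hg hm hζ hx (u k P g) = !![0, ζ; 1, 0] := by
  rw [orbitMatrixRep_u, swapHom_gen]

/-- The representation on `k²` attached to an orbit `{x, x ◁ g}` and a character of the
stabilizer. -/
def orbitRep : Bismash k P →ₐ[k] Module.End k (Fin 2 → k) :=
  (Matrix.toLinAlgEquiv' : Matrix (Fin 2) (Fin 2) k ≃ₐ[k] _).toAlgHom.comp
    (orbitMatrixRep hg hm hζ hx)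

theorem orbitRep_apply (h : Bismash k P) (w : Fin 2 → k) :
    orbitRep hg hm hζ hx h w = (orbitMatrixRep hg hm hζ hx h).mulVec w := rfl

open scoped Classical in
theorem orbitRep_p_one (z : G) (w : Fin 2 → k) : orbitRep hg hm hζ hx (p k P z 1) w =
    ![if z = x then w 0 else 0, if z = P.ract x g then w 1 else 0] := by
  rw [orbitRep_apply, orbitMatrixRep_p_one]
  ext i
  fin_cases i <;> simp [coordProj, Matrix.mulVec_diagonal]

theorem orbitRep_gen (w : Fin 2 → k) : orbitRep hg hm hζ hx (u k P g) w = ![ζ * w 1, w 0] := by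
  rw [orbitRep_apply, orbitMatrixRep_gen]
  ext i
  fin_cases i <;> simp [Matrix.mulVec, dotProduct]

/-- As `x ≠ x ◁ g`, the projections to both coordinate lines lie in the image of the algebra, and
`g` exchanges the two lines. -/
theorem orbitRep_irreducible (hx' : P.ract x g ≠ x) (W : Submodule k (Fin 2 → k))
    (hW : ∀ h, ∀ w ∈ W, orbitRep hg hm hζ hx h w ∈ W) : W = ⊥ ∨ W = ⊤ := by
  have hζ0 : ζ ≠ 0 := by
    rintro rfl
    simp [zero_pow (NeZero.ne m)] at hζ
  refine or_iff_not_imp_left.mpr fun h => ?_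
  obtain ⟨w, hw, hw0⟩ := W.ne_bot_iff.mp h
  have hgen : ∀ c d : k, ![c, d] ∈ W → ![ζ * d, c] ∈ W := fun c d h => by
    simpa [orbitRep_gen] using hW (u k P g) _ h
  have key : (![1, 0] : Fin 2 → k) ∈ W := by
    by_cases h0 : w 0 = 0
    · have h1 : w 1 ≠ 0 := fun h1 => hw0 (by ext i; fin_cases i <;> simp [h0, h1])
      have e := hW (p k P (P.ract x g) 1) w hw
      rw [orbitRep_p_one, if_neg hx', if_pos rfl] at e
      -- The projection gives `(0, w 1)`, which `g` sends to `(ζ * w 1, 0)`.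
      simpa [inv_mul_cancel₀ (mul_ne_zero hζ0 h1), -mul_inv_rev] using
        W.smul_mem (ζ * w 1)⁻¹ (hgen _ _ e)
    · have e := hW (p k P x 1) w hw
      rw [orbitRep_p_one, if_neg hx'.symm, if_pos rfl] at e
      simpa [h0] using W.smul_mem (w 0)⁻¹ e
  have key' : (![0, 1] : Fin 2 → k) ∈ W := by simpa using hgen _ _ key
  refine (Submodule.eq_top_iff').mpr fun v => ?_
  have hv : v = v 0 • ![1, 0] + v 1 • ![0, 1] := by ext i; fin_cases i <;> simp
  rw [hv]
  exact W.add_mem (W.smul_mem _ key) (W.smul_mem _ key')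

/-- The two-dimensional irrep attached to an orbit `{x, x ◁ g}` of size two and a character of the
stabilizer. -/
def orbitIrrep (hx' : P.ract x g ≠ x) : Irrep k (Bismash k P) 2 :=
  Irrep.ofAlgHom (orbitRep hg hm hζ hx) (orbitRep_irreducible hg hm hζ hx hx') (by simp)

theorem character_orbitIrrep (hx' : P.ract x g ≠ x) (h : Bismash k P) :
    (orbitIrrep hg hm hζ hx hx').character h = (orbitMatrixRep hg hm hζ hx h).trace :=
  (Irrep.character_ofAlgHom _ _ _ _).trans (Matrix.trace_toLin'_eq _)

theorem character_orbitIrrep_p_eq_zero (hx' : P.ract x g ≠ x) {z : G} (hz : z ≠ x)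
    (hz' : z ≠ P.ract x g) (b : F) :
    (orbitIrrep hg hm hζ hx hx').character (p k P z b) = 0 := by
  have h : coordProj k x (P.ract x g) z = 0 := by
    ext i j
    fin_cases i <;> fin_cases j <;> simp [coordProj, hz, hz']
  rw [character_orbitIrrep, orbitMatrixRep_p, h, zero_mul, Matrix.trace_zero]

theorem character_orbitIrrep_p_one (hx' : P.ract x g ≠ x) :
    (orbitIrrep hg hm hζ hx hx').character (p k P x 1) = 1 := by
  rw [character_orbitIrrep, orbitMatrixRep_p_one]
  simp [coordProj, hx'.symm]

/-- Since `g ^ 2` acts as the scalar `ζ`, the character determines `ζ`. -/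
theorem character_orbitIrrep_u_sq (hx' : P.ract x g ≠ x) :
    (orbitIrrep hg hm hζ hx hx').character (u k P (g ^ 2)) = 2 * ζ := by
  rw [character_orbitIrrep, u_pow, map_pow, orbitMatrixRep_gen]
  simp [pow_two, Matrix.trace_fin_two, two_mul]

/-- Isomorphic irreps come from the same orbit and the same character of the stabilizer. -/
theorem orbitIrrep_equiv [CharZero k] (hx' : P.ract x g ≠ x) {ξ : k} {hξ : ξ ^ m = 1} {y : G}
    {hy : P.ract (P.ract y g) g = y} {hy' : P.ract y g ≠ y}
    (h : orbitIrrep hg hm hζ hx hx' ≈ orbitIrrep hg hm hξ hy hy') :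
    ζ = ξ ∧ (x = y ∨ x = P.ract y g) := by
  obtain ⟨e⟩ := h
  have hc := Irrep.character_congr e
  constructor
  · have h2 := hc (u k P (g ^ 2))
    rw [character_orbitIrrep_u_sq, character_orbitIrrep_u_sq] at h2
    exact mul_left_cancel₀ two_ne_zero h2
  · by_contra! hne
    have h1 := hc (p k P x 1)
    rw [character_orbitIrrep_p_one, character_orbitIrrep_p_eq_zero _ _ _ _ _ hne.1 hne.2] at h1
    exact one_ne_zero h1

include hg hm in
/-- Every two-dimensional irrep comes from an orbit of size two. -/
theorem exists_orbitIrrep [IsAlgClosed k] (A : Irrep k (Bismash k P) 2) :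
    ∃ (ζ : k) (hζ : ζ ^ m = 1) (x : G) (hx : P.ract (P.ract x g) g = x) (hx' : P.ract x g ≠ x),
      orbitIrrep hg hm hζ hx hx' ≈ A := by
  classical
  have : Nontrivial A.V := Module.nontrivial_of_finrank_pos (R := k) (by rw [A.finrank_eq]; simp)
  obtain ⟨v₀, hv₀⟩ := exists_ne (0 : A.V)
  obtain ⟨x, hx⟩ : ∃ x, p k P x 1 • v₀ ≠ 0 := by
    by_contra! h
    apply hv₀
    rw [← one_smul (Bismash k P) v₀, one_def, Finset.sum_smul]
    exact Finset.sum_eq_zero fun x _ => h x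
  -- For a fixed point `x`, an eigenvector of `g` in `p_x V` spans a submodule of dimension 1, which
  -- would be all of `V`.
  have h1 : P.ract x g ≠ x := by
    intro h
    obtain ⟨v, hv, hpv, ζ, hζ⟩ := exists_eigenvector h hx
    have htop : Submodule.span k {v} = ⊤ := by
      refine eq_top_of_gen (P := P) hg ?_ ?_ (by simpa using hv)
      · intro z w hw
        obtain ⟨c, rfl⟩ := Submodule.mem_span_singleton.mp hw
        rw [smul_comm, p_one_smul hpv]
        refine Submodule.smul_mem _ _ ?_
        split_ifs
        · exact Submodule.mem_span_singleton_self v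
        · exact Submodule.zero_mem _
      · intro w hw
        obtain ⟨c, rfl⟩ := Submodule.mem_span_singleton.mp hw
        rw [smul_comm, hζ]
        exact Submodule.smul_mem _ _ (Submodule.smul_mem _ _ (Submodule.mem_span_singleton_self v))
    have := finrank_span_singleton (K := k) hv
    rw [htop, finrank_top, A.finrank_eq] at this
    norm_num at this
  -- Otherwise `x`, `x ◁ g`, `x ◁ g²` are distinct and their components contain three independent
  -- vectors.
  have h2 : P.ract (P.ract x g) g = x := by
    by_contra h
    have h3 : P.ract (P.ract x g) g ≠ P.ract x g := fun h' => h1 (P.ract_injective g h')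
    have hpp : p k P x 1 • p k P x 1 • v₀ = p k P x 1 • v₀ := by
      rw [← mul_smul, p_one_mul_p_one, if_pos rfl]
    have hli := linearIndependent_of_p_one_smul (k := k) (P := P)
      (y := fun i : Fin 3 => P.ract x (g ^ (i : ℕ)))
      (v := fun i : Fin 3 => u k P (g ^ (i : ℕ))⁻¹ • p k P x 1 • v₀)
      (by
        intro i j hij
        fin_cases i <;> fin_cases j <;>
          simp_all [P.ract_one, pow_two, P.ract_mul, eq_comm])
      (fun i => u_smul_ne_zero hx _)
      (fun i => p_one_smul_u_smul hpp (by rw [← P.ract_mul, mul_inv_cancel, P.ract_one]))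
    have := hli.fintype_card_le_finrank
    rw [A.finrank_eq] at this
    norm_num at this
  obtain ⟨v, hv, hpv, ζ, hζv⟩ := exists_eigenvector (b := g ^ 2)
    (by rw [pow_two, P.ract_mul, h2]) hx
  -- The `m`-th power of `g ^ 2` is 1 because `g` has order `2 * m`.
  have hζ : ζ ^ m = 1 := by
    have h : ∀ r : ℕ, u k P (g ^ 2) ^ r • v = ζ ^ r • v := by
      intro r
      induction r with
      | zero => simp
      | succ r ih => rw [pow_succ', mul_smul, ih, smul_comm, hζv, smul_smul, pow_succ]
    have h' := h m
    rw [← u_pow, ← pow_mul, ← hm, pow_orderOf_eq_one, u_one, one_smul] at h'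
    refine smul_left_injective k hv ?_
    simp only [one_smul, ← h']
  refine ⟨ζ, hζ, x, h2, h1, ?_⟩
  have hpu : p k P (P.ract x g) 1 • u k P g • v = u k P g • v := p_one_smul_u_smul hpv h2
  -- The basis of `k²` goes to `v` and `g v`. By `g² v = ζ v` the action of `g` on them is the
  -- matrix `(0 ζ; 1 0)`.
  let f₀ : (Fin 2 → k) →ₗ[k] A.V :=
    (LinearMap.toSpanSingleton k A.V v).comp (LinearMap.proj (0 : Fin 2)) +
      (LinearMap.toSpanSingleton k A.V (u k P g • v)).comp (LinearMap.proj (1 : Fin 2))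
  have hf₀ : ∀ w : Fin 2 → k, f₀ w = w 0 • v + w 1 • u k P g • v := fun w => rfl
  have hfp : ∀ z w, f₀ (orbitRep hg hm hζ h2 (p k P z 1) w) = p k P z 1 • f₀ w := by
    intro z w
    rw [orbitRep_p_one, hf₀, hf₀, smul_add, smul_comm _ (w 0), smul_comm _ (w 1),
      p_one_smul hpv, p_one_smul hpu]
    by_cases e : z = x <;> by_cases e' : z = P.ract x g <;> simp [e, e']
  have hfu : ∀ w, f₀ (orbitRep hg hm hζ h2 (u k P g) w) = u k P g • f₀ w := by
    intro w
    rw [orbitRep_gen, hf₀, hf₀, smul_add, smul_comm _ (w 0), smul_comm _ (w 1),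
      ← mul_smul (u k P g), ← pow_two, ← u_pow, hζv]
    simp [mul_smul, smul_comm ζ, add_comm]
  let f : (orbitIrrep hg hm hζ h2 h1).V →ₗ[Bismash k P] A.V :=
    let f₁ : (orbitIrrep hg hm hζ h2 h1).V →ₗ[k] A.V := f₀
    linearMapOfGen hg f₁ hfp hfu
  have hf : f ≠ 0 := by
    intro h
    apply hv
    have := hf₀ ![1, 0]
    simp only [Matrix.cons_val_zero, Matrix.cons_val_one, one_smul, zero_smul, add_zero] at this
    rw [← this]
    exact LinearMap.congr_fun h ![1, 0]
  -- Schur's lemma: a nonzero map between simple modules is bijective.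
  exact ⟨LinearEquiv.ofBijective f (LinearMap.bijective_of_ne_zero hf)⟩

end OrbitIrrep

end Bismash

/-! ### Vanishing of indicators. -/

namespace Bismash

universe u

/-- The indicator of the irrep attached to an orbit vanishes unless the orbit is closed under
inversion. -/
theorem exists_inv_of_indicator_ne_zero {k : Type u} [Field k] [CharZero k] {F G : Type} [Group F]
    [Fintype F] [Group G] [Fintype G] {P : MatchedPair F G} {g : F} {m : ℕ} [NeZero m]
    (hg : ∀ b : F, b ∈ Subgroup.zpowers g) (hm : orderOf g = 2 * m) {ζ : k} (hζ : ζ ^ m = 1)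
    {x : G} (hx : P.ract (P.ract x g) g = x) (hx' : P.ract x g ≠ x)
    (h : (orbitIrrep hg hm hζ hx hx').indicator ≠ 0) :
    ∃ (z : G) (b : F), (z = x ∨ z = P.ract x g) ∧ P.ract z⁻¹ b = z := by
  classical
  by_contra! hne
  apply h
  have hzero : ∀ (y : G) (b : F), (orbitIrrep hg hm hζ hx hx').character
      (p k P (1 * y⁻¹) (P.lact y b) * p k P y b) = 0 := by
    intro y b
    rw [p_mul_p, one_mul]
    split_ifs with e
    -- Here `e` says `y = y⁻¹ ◁ (y ▷ b)`. Acting by `b` on `y⁻¹ y = 1` gives `(y⁻¹ ◁ (y ▷ b))(y ◁ b)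
    -- = 1`. So `z = y⁻¹` satisfies `z⁻¹ ◁ b = z`, and by assumption it lies outside the orbit,
    -- where the character vanishes.
    · have e' : P.ract y b = y⁻¹ := by
        rw [eq_inv_iff_mul_eq_one, mul_eq_one_iff_eq_inv]
        have := P.mul_ract y⁻¹ y b
        rw [inv_mul_cancel, P.one_ract, ← e] at this
        exact (inv_eq_of_mul_eq_one_right this.symm).symm
      have hy := hne y⁻¹ b
      rw [inv_inv] at hy
      exact character_orbitIrrep_p_eq_zero _ _ _ _ _ (fun h => hy (Or.inl h) e')
        (fun h => hy (Or.inr h) e') _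
    · rw [character_orbitIrrep, map_zero, Matrix.trace_zero]
  simp only [character_orbitIrrep] at hzero
  rw [Irrep.indicator, (isNormalizedIntegral P).eq, character_orbitIrrep]
  simp only [map_smul, map_sum, comul_p, LinearMap.mul'_apply, Matrix.trace_smul, Matrix.trace_sum,
    hzero, Finset.sum_const_zero, smul_zero]

end Bismash

/-! ### Orbits of size at most two in the point stabilizer, as permutations of `ℤ/n`. -/

section Orbits

variable {n : ℕ}

variable (n) in
/-- The standard `n`-cycle, as an element of `C_n`. -/
def cycleGen : cyclicSubgroup n := ⟨stdCycle n, Subgroup.mem_zpowers _⟩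

theorem cyclicSubgroup_apply (b : cyclicSubgroup n) (i : ZMod n) : b.1 i = i + b.1 0 := by
  obtain ⟨_, r, rfl⟩ := b
  change (stdCycle n ^ r) i = i + (stdCycle n ^ r) 0
  simp [stdCycle_zpow_apply]

theorem mem_zpowers_cycleGen (b : cyclicSubgroup n) : b ∈ Subgroup.zpowers (cycleGen n) := by
  obtain ⟨_, r, rfl⟩ := b
  exact ⟨r, rfl⟩

theorem orderOf_cycleGen : orderOf (cycleGen n) = n := by
  rw [cycleGen, Subgroup.orderOf_mk]
  refine Nat.dvd_antisymm (orderOf_dvd_of_pow_eq_one ?_) ?_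
  · ext i
    rw [← zpow_natCast, stdCycle_zpow_apply]
    simp
  · have h := congrArg (fun σ : Equiv.Perm (ZMod n) => σ 0) (pow_orderOf_eq_one (stdCycle n))
    simp only [← zpow_natCast, stdCycle_zpow_apply] at h
    rw [← ZMod.natCast_eq_zero_iff]
    simpa using h

theorem pointSubgroup_apply_zero (x : pointSubgroup n) : x.1 0 = 0 := x.2

/-- In `x b = (x ▷ b)(x ◁ b)` the factor `x ▷ b` is a translation and `x ◁ b` fixes 0. Evaluation at
0 shows that the translation is by `x (b 0)`. -/
theorem ract_apply (x : pointSubgroup n) (b : cyclicSubgroup n) (i : ZMod n) :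
    ((matchedPairSn n).ract x b).1 i = x.1 (i + b.1 0) - x.1 (b.1 0) := by
  have h := MatchedPair.ofIsComplement_spec (isComplement_cyclic_point n) x b
  have h' : ∀ j, x.1 (b.1 j) = ((matchedPairSn n).lact x b).1
      (((matchedPairSn n).ract x b).1 j) := fun j =>
    congrArg (fun σ : Equiv.Perm (ZMod n) => σ j) h
  have h0 := h' 0
  rw [pointSubgroup_apply_zero] at h0
  have hi := h' i
  rw [cyclicSubgroup_apply b, cyclicSubgroup_apply ((matchedPairSn n).lact x b), ← h0] at hi
  rw [hi, add_sub_cancel_right]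

theorem ract_cycleGen_apply (x : pointSubgroup n) (i : ZMod n) :
    ((matchedPairSn n).ract x (cycleGen n)).1 i = x.1 (i + 1) - x.1 1 := by
  have h : (cycleGen n).1 0 = 1 := by simp [cycleGen, stdCycle]
  rw [ract_apply, h]

theorem ract_cycleGen_sq_eq_iff (x : pointSubgroup n) :
    (matchedPairSn n).ract ((matchedPairSn n).ract x (cycleGen n)) (cycleGen n) = x ↔
      ∀ i, x.1 (i + 2) = x.1 i + x.1 2 := by
  rw [Subtype.ext_iff, Equiv.ext_iff]
  refine forall_congr' fun i => ?_
  rw [ract_cycleGen_apply, ract_cycleGen_apply, ract_cycleGen_apply, sub_sub_sub_cancel_right,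
    add_assoc, one_add_one_eq_two, sub_eq_iff_eq_add]

theorem apply_add_two_mul [NeZero n] {x : pointSubgroup n} (hx : ∀ i, x.1 (i + 2) = x.1 i + x.1 2)
    (i j : ZMod n) : x.1 (i + 2 * j) = x.1 i + j * x.1 2 := by
  obtain ⟨r, rfl⟩ := ZMod.natCast_zmod_surjective j
  induction r with
  | zero => simp
  | succ r ih =>
    have e : i + 2 * ((r + 1 : ℕ) : ZMod n) = i + 2 * (r : ZMod n) + 2 := by push_cast; ring
    rw [e, hx, ih]
    push_cast
    ring

theorem apply_two_mul [NeZero n] {x : pointSubgroup n} (hx : ∀ i, x.1 (i + 2) = x.1 i + x.1 2)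
    (j : ZMod n) : x.1 (2 * j) = j * x.1 2 := by
  simpa [pointSubgroup_apply_zero] using apply_add_two_mul hx 0 j

/-- From `0 = x(2m) = m * x(2)` in `ℤ/2m`, the residue `x(2)` is even. This allows `x` to be
evaluated at `x(2)` through `apply_two_mul`. -/
theorem exists_two_mul_of_apply_two {m : ℕ} [NeZero m] {x : pointSubgroup (2 * m)}
    (hx : ∀ i, x.1 (i + 2) = x.1 i + x.1 2) : ∃ u, x.1 2 = 2 * u := by
  have h := apply_two_mul hx (m : ZMod (2 * m))
  have e : (2 * (m : ZMod (2 * m))) = 0 := by exact_mod_cast ZMod.natCast_self (2 * m)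
  rw [e, pointSubgroup_apply_zero] at h
  obtain ⟨c, hc⟩ := ZMod.natCast_zmod_surjective (x.1 2)
  rw [← hc] at h ⊢
  have h' : ((m * c : ℕ) : ZMod (2 * m)) = 0 := by push_cast; exact h.symm
  rw [ZMod.natCast_eq_zero_iff, mul_comm 2 m] at h'
  obtain ⟨d, rfl⟩ := Nat.dvd_of_mul_dvd_mul_left (Nat.pos_of_ne_zero (NeZero.ne m)) h'
  exact ⟨d, by push_cast; rfl⟩

/-- If the orbit of `x` is closed under inversion, then `x (x 2) = 2`. -/
theorem apply_apply_two_of_inv {m : ℕ} [NeZero m] {x z : pointSubgroup (2 * m)}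
    (hx : ∀ i, x.1 (i + 2) = x.1 i + x.1 2)
    (hz : z = x ∨ z = (matchedPairSn (2 * m)).ract x (cycleGen (2 * m)))
    {b : cyclicSubgroup (2 * m)} (hzb : (matchedPairSn (2 * m)).ract z⁻¹ b = z) :
    x.1 (x.1 2) = 2 := by
  -- Both points of the orbit have the same increment over a shift by 2, so it does not matter which
  -- of them is `z`.
  obtain ⟨hz1, hz2⟩ : (∀ i, z.1 (i + 2) = z.1 i + z.1 2) ∧ z.1 2 = x.1 2 := by
    rcases hz with rfl | rfl
    · exact ⟨hx, rfl⟩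
    · simp only [ract_cycleGen_apply, add_right_comm _ (2 : ZMod (2 * m)) 1, hx,
        add_comm (2 : ZMod (2 * m)) 1]
      refine ⟨fun i => ?_, ?_⟩ <;> ring
  obtain ⟨c, hc⟩ := exists_two_mul_of_apply_two hx
  have h := ract_apply z⁻¹ b 2
  rw [hzb] at h
  have h1 : z.1 2 + z.1⁻¹ (b.1 0) = z.1⁻¹ (2 + b.1 0) := by
    rw [h]
    exact sub_add_cancel _ _
  -- With `x(2) = 2c`, applying `z` to `2c + z⁻¹(b 0) = z⁻¹(2 + b 0)` gives `b 0 + c * x(2) = 2 + b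
  -- 0`. Hence `x(x 2) = c * x(2) = 2`.
  have h2 := congrArg z.1 h1
  have hinv : ∀ i, z.1 (z.1⁻¹ i) = i := z.1.apply_symm_apply
  rw [hinv, hz2, hc, add_comm, apply_add_two_mul hz1, hz2,
    hinv, add_comm, add_left_inj] at h2
  rw [hc, apply_two_mul hx, h2]

/-! ### Multiplication by units and the proportion of points with `x(x 2) = 2`. -/

/-- Multiplication by a unit of `ℤ/n`. -/
def unitMul (v : (ZMod n)ˣ) (x : pointSubgroup n) : pointSubgroup n :=
  ⟨v.mulLeft * x.1, by
    change v.mulLeft (x.1 0) = 0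
    rw [pointSubgroup_apply_zero]
    simp⟩

theorem unitMul_apply (v : (ZMod n)ˣ) (x : pointSubgroup n) (i : ZMod n) :
    (unitMul v x).1 i = v * x.1 i := rfl

theorem unitMul_injective (v : (ZMod n)ˣ) : Function.Injective (unitMul v) := by
  intro x y h
  ext i
  exact v.isUnit.mul_left_cancel (congrArg (fun z : pointSubgroup n => z.1 i) h)

theorem ract_unitMul (v : (ZMod n)ˣ) (x : pointSubgroup n) (b : cyclicSubgroup n) :
    (matchedPairSn n).ract (unitMul v x) b = unitMul v ((matchedPairSn n).ract x b) := by
  ext i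
  rw [unitMul_apply, ract_apply, ract_apply, unitMul_apply, unitMul_apply, mul_sub]

variable (n) in
/-- The units `v` of `ℤ/n` with `2v² = 2`. -/
def twoSqSubgroup : Subgroup (ZMod n)ˣ where
  carrier := {v | (v : ZMod n) ^ 2 * 2 = 2}
  one_mem' := by simp
  mul_mem' {v w} hv hw := by
    simp only [Set.mem_ofPred_eq, Units.val_mul, mul_pow] at *
    rw [mul_assoc, hw, hv]
  inv_mem' {v} hv := by
    simp only [Set.mem_ofPred_eq] at *
    conv_lhs => rw [← hv]
    rw [← mul_assoc, ← mul_pow, Units.inv_mul, one_pow, one_mul]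

variable (n) in
/-- The elements of `S_{n-1}` in an orbit of size two. -/
def OrbitPoint : Type :=
  {x : pointSubgroup n //
    (matchedPairSn n).ract ((matchedPairSn n).ract x (cycleGen n)) (cycleGen n) = x ∧
      (matchedPairSn n).ract x (cycleGen n) ≠ x}

instance [NeZero n] : Finite (OrbitPoint n) := inferInstanceAs (Finite (Subtype _))

/-- Multiplication by a unit of `ℤ/n` on the elements in orbits of size two. -/
def OrbitPoint.unitMul (v : (ZMod n)ˣ) (x : OrbitPoint n) : OrbitPoint n :=
  ⟨_root_.unitMul v x.1, by
    rw [ract_unitMul, ract_unitMul, x.2.1], by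
    rw [ract_unitMul]
    exact fun h => x.2.2 (unitMul_injective v h)⟩

/-- Translates of points with `x(x 2) = 2` by representatives of distinct cosets are distinct. If `y
= v x` with both satisfying the condition and `x(2) = 2c`, then `2 = y(y 2) = v * x(2vc) = v² * c *
x(2) = 2v²`. -/
theorem card_selfInverse_mul_index_le {m : ℕ} [NeZero m] :
    Nat.card {x : OrbitPoint (2 * m) // x.1.1 (x.1.1 2) = 2} * (twoSqSubgroup (2 * m)).index ≤
      Nat.card (OrbitPoint (2 * m)) := by
  rw [Subgroup.index, ← Nat.card_prod]
  refine Nat.card_le_card_of_injective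
    (fun q => OrbitPoint.unitMul (Quotient.out q.2) q.1.1) ?_
  rintro ⟨⟨x, hx⟩, q⟩ ⟨⟨y, hy⟩, r⟩ h
  have h1 : ∀ i, (q.out : ZMod (2 * m)) * x.1.1 i = (r.out : ZMod (2 * m)) * y.1.1 i := fun i =>
    congrArg (fun z : OrbitPoint (2 * m) => z.1.1 i) h
  have h2 : ∀ i, y.1.1 i = ((r.out⁻¹ * q.out : (ZMod (2 * m))ˣ) : ZMod (2 * m)) * x.1.1 i := by
    intro i
    rw [Units.val_mul, mul_assoc, h1, ← mul_assoc, Units.inv_mul, one_mul]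
  have hx2 := (ract_cycleGen_sq_eq_iff _).mp x.2.1
  obtain ⟨c, hc⟩ := exists_two_mul_of_apply_two hx2
  have hmem : r.out⁻¹ * q.out ∈ twoSqSubgroup (2 * m) := by
    change ((r.out⁻¹ * q.out : (ZMod (2 * m))ˣ) : ZMod (2 * m)) ^ 2 * 2 = 2
    rw [hc, apply_two_mul hx2] at hx
    rw [h2, h2, hc, mul_left_comm, apply_two_mul hx2, mul_assoc, hx, ← mul_assoc, ← pow_two] at hy
    exact hy
  have hqr : r = q := by
    rw [← QuotientGroup.out_eq' r, ← QuotientGroup.out_eq' q]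
    exact QuotientGroup.eq.mpr hmem
  subst hqr
  have hxy : x = y := Subtype.ext (unitMul_injective _ (congrArg Subtype.val h))
  subst hxy
  rfl

/-! ### Growth of the index, and existence of orbits of size two. -/

/-- The index of the subgroup of all `v` with `2v² = 2` grows with `m`. -/
theorem le_pow_index_twoSqSubgroup (m : ℕ) [NeZero m] :
    m ≤ 36 ^ (twoSqSubgroup (2 * m)).index := by
  set j := (twoSqSubgroup (2 * m)).index
  have hm : m ≠ 0 := NeZero.ne m
  have hj0 : j ≠ 0 := Subgroup.index_ne_zero_of_finite
  -- The `j`-th power of a unit lies in the subgroup of index `j`, so `2 w^(2j) = 2` modulo `2m`.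
  have hdvd : ∀ w : ℕ, w.Coprime (2 * m) → (m : ℤ) ∣ (w : ℤ) ^ (2 * j) - 1 := by
    intro w hw
    have h : ((ZMod.unitOfCoprime w hw ^ j : (ZMod (2 * m))ˣ) : ZMod (2 * m)) ^ 2 * 2 = 2 :=
      Subgroup.pow_index_mem (twoSqSubgroup (2 * m)) (ZMod.unitOfCoprime w hw)
    rw [Units.val_pow_eq_pow_val, ZMod.coe_unitOfCoprime, ← pow_mul, mul_comm j 2] at h
    have h' : ((2 * ((w : ℤ) ^ (2 * j) - 1) : ℤ) : ZMod (2 * m)) = 0 := by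
      push_cast
      linear_combination h
    rw [ZMod.intCast_zmod_eq_zero_iff_dvd] at h'
    push_cast at h'
    exact (mul_dvd_mul_iff_left two_ne_zero).mp h'
  obtain ⟨a, q, hq, hmq⟩ := Nat.exists_eq_two_pow_mul_odd hm
  have hcop : (2 ^ (a + 1)).Coprime q := Nat.Coprime.pow_left _ (Nat.coprime_two_left.mpr hq)
  -- With `q` odd and `2m = 2^(a+1) q`, the residues 3 and 2 make `w` a unit modulo `2m`. Being
  -- small, they bound the two factors of `m` separately, by `3^(2j)` and `2^(2j)`. This is the
  -- source of `36 = 3² * 2²`.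
  obtain ⟨w, hw1, hw2⟩ := Nat.chineseRemainder hcop 3 2
  have hwc : w.Coprime (2 * m) := by
    rw [hmq, ← mul_assoc, ← pow_succ']
    refine Nat.Coprime.mul_right ?_ ?_
    · rw [Nat.Coprime, hw1.gcd_eq]
      exact Nat.Coprime.pow_right _ (by norm_num)
    · rw [Nat.Coprime, hw2.gcd_eq]
      exact Nat.coprime_two_left.mpr hq
  have hmw := hdvd w hwc
  have bound : ∀ (d e : ℕ), 2 ≤ e → d ∣ m → w ≡ e [MOD d] → d ≤ e ^ (2 * j) := by
    intro d e he hd hwe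
    have h1 : (d : ℤ) ∣ (w : ℤ) ^ (2 * j) - 1 := (Int.natCast_dvd_natCast.mpr hd).trans hmw
    have h2 : (w : ℤ) ^ (2 * j) ≡ (e : ℤ) ^ (2 * j) [ZMOD d] :=
      (Int.natCast_modEq_iff.mpr hwe).pow _
    have h3 : (d : ℤ) ∣ (e : ℤ) ^ (2 * j) - 1 := by
      have := (h2.dvd).add h1
      simpa using this
    -- The divisibility by `d` bounds `d` only because `e^(2j) - 1` is positive, which uses `j ≠ 0`.
    have h4 : (1 : ℤ) < (e : ℤ) ^ (2 * j) :=
      one_lt_pow₀ (by exact_mod_cast he) (by positivity)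
    have h5 := Int.le_of_dvd (by linarith) h3
    have h6 : (d : ℤ) ≤ (e : ℤ) ^ (2 * j) := by linarith
    exact_mod_cast h6
  have b1 := bound (2 ^ a) 3 (by norm_num) (hmq ▸ Dvd.intro _ rfl)
    (hw1.of_dvd (pow_dvd_pow 2 a.le_succ))
  have b2 := bound q 2 le_rfl (hmq ▸ Dvd.intro_left _ rfl) hw2
  calc m = 2 ^ a * q := hmq
    _ ≤ 3 ^ (2 * j) * 2 ^ (2 * j) := Nat.mul_le_mul b1 b2
    _ = 36 ^ j := by rw [← mul_pow, pow_mul]; norm_num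

theorem nonempty_orbitPoint {m : ℕ} [NeZero m] (hm : 3 ≤ m) : Nonempty (OrbitPoint (2 * m)) := by
  classical
  let φ := ZMod.castHom (dvd_mul_right 2 m) (ZMod 2)
  have hφ2 : φ 2 = 0 := by rw [map_ofNat]; rfl
  -- The permutation fixes the even residues and shifts the odd ones by 2. If `◁ g` fixed it, then
  -- `4 = 0` in `ℤ/2m`, which fails for `m ≥ 3`.
  let σ : Equiv.Perm (ZMod (2 * m)) :=
    { toFun := fun i => if φ i = 0 then i else i + 2
      invFun := fun i => if φ i = 0 then i else i - 2
      left_inv := fun i => by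
        by_cases h : φ i = 0 <;> simp [h, hφ2]
      right_inv := fun i => by
        by_cases h : φ i = 0 <;> simp [h, hφ2] }
  have hσ : ∀ i, σ i = if φ i = 0 then i else i + 2 := fun i => rfl
  have h0 : σ 0 = 0 := by simp [hσ]
  have h1 : σ 1 = 1 + 2 := by simp [hσ]
  have h2 : σ 2 = 2 := by simp [hσ, hφ2]
  refine ⟨⟨⟨σ, h0⟩, (ract_cycleGen_sq_eq_iff _).mpr fun i => ?_, fun h => ?_⟩⟩
  · change σ (i + 2) = σ i + σ 2
    rw [h2, hσ, hσ, map_add, hφ2, add_zero]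
    split_ifs <;> rfl
  · have h3 := ract_cycleGen_apply (⟨σ, h0⟩ : pointSubgroup (2 * m)) 1
    rw [h] at h3
    change σ 1 = σ (1 + 1) - σ 1 at h3
    rw [one_add_one_eq_two, h1, h2] at h3
    have h4 : ((4 : ℕ) : ZMod (2 * m)) = 0 := by
      push_cast
      linear_combination h3
    have := Nat.le_of_dvd (by norm_num) ((ZMod.natCast_eq_zero_iff _ _).mp h4)
    omega

end Orbits

/-! ### Counting the 2-dimensional irreps and bounding the ratio. -/

section Count

universe u

variable {k : Type u} [Field k] {m : ℕ} [NeZero m]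

/-- The irrep of `J_{2m}` attached to an element in an orbit of size two and an `m`-th root of
unity. -/
def OrbitPoint.irrep (i : OrbitPoint (2 * m) × {ζ : k // ζ ^ m = 1}) :
    Irrep k (BismashJ (2 * m) k) 2 :=
  Bismash.orbitIrrep mem_zpowers_cycleGen orderOf_cycleGen i.2.2 i.1.2.1 i.1.2.2

/-- The isomorphism class of `OrbitPoint.irrep`. -/
def OrbitPoint.irrepClass (i : OrbitPoint (2 * m) × {ζ : k // ζ ^ m = 1}) :
    IrrepClass k (BismashJ (2 * m) k) 2 :=
  Quotient.mk _ (OrbitPoint.irrep i)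

theorem OrbitPoint.irrepClass_surjective [IsAlgClosed k] :
    Function.Surjective (OrbitPoint.irrepClass (k := k) (m := m)) := by
  intro q
  induction q using Quotient.inductionOn with
  | h A =>
  obtain ⟨ζ, hζ, x, hx, hx', h⟩ := Bismash.exists_orbitIrrep (g := cycleGen (2 * m)) (m := m)
    mem_zpowers_cycleGen orderOf_cycleGen A
  exact ⟨(⟨x, hx, hx'⟩, ⟨ζ, hζ⟩), Quotient.sound h⟩

theorem OrbitPoint.irrepClass_eq [CharZero k] {x y : OrbitPoint (2 * m)}
    {ζ ξ : {ζ : k // ζ ^ m = 1}} (h : irrepClass (x, ζ) = irrepClass (y, ξ)) :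
    ζ = ξ ∧ (x.1 = y.1 ∨ x.1 = (matchedPairSn (2 * m)).ract y.1 (cycleGen (2 * m))) := by
  obtain ⟨h1, h2⟩ := Bismash.orbitIrrep_equiv _ _ _ _ _ (Quotient.exact h)
  exact ⟨Subtype.ext h1, h2⟩

theorem OrbitPoint.apply_apply_two_of_indicator_ne_zero [CharZero k]
    {i : OrbitPoint (2 * m) × {ζ : k // ζ ^ m = 1}} (h : (irrepClass i).indicator ≠ 0) :
    i.1.1.1 (i.1.1.1 2) = 2 := by
  obtain ⟨z, b, hz, hb⟩ := Bismash.exists_inv_of_indicator_ne_zero _ _ _ _ _ h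
  exact apply_apply_two_of_inv ((ract_cycleGen_sq_eq_iff _).mp i.1.2.1) hz hb

variable (k m) in
theorem finite_rootsOfOne : Finite {ζ : k // ζ ^ m = 1} := by
  classical
  refine Set.Finite.to_subtype (s := {ζ : k | ζ ^ m = 1})
    (((Polynomial.nthRoots m (1 : k)).toFinset.finite_toSet).subset fun ζ hζ => ?_)
  simpa [Polynomial.mem_nthRoots (Nat.pos_of_ne_zero (NeZero.ne m))] using hζ

variable (k m) in
theorem finite_irrepClass [IsAlgClosed k] : Finite (IrrepClass k (BismashJ (2 * m) k) 2) :=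
  have := finite_rootsOfOne k m
  Finite.of_surjective _ OrbitPoint.irrepClass_surjective

-- Each isomorphism class comes from one root of unity and at most two points, those of a single
-- orbit.
variable (k m) in
theorem card_orbitPoint_mul_le [IsAlgClosed k] [CharZero k] :
    Nat.card (OrbitPoint (2 * m)) * Nat.card {ζ : k // ζ ^ m = 1} ≤
      Nat.card (IrrepClass k (BismashJ (2 * m) k) 2) * 2 := by
  classical
  have := finite_irrepClass k m
  let r := Function.surjInv (OrbitPoint.irrepClass_surjective (k := k) (m := m))
  have hr : ∀ q, OrbitPoint.irrepClass (r q) = q := Function.surjInv_eq _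
  have hbool : Nat.card (IrrepClass k (BismashJ (2 * m) k) 2 × Bool) =
      Nat.card (IrrepClass k (BismashJ (2 * m) k) 2) * 2 := by
    rw [Nat.card_prod, Nat.card_eq_fintype_card (α := Bool), Fintype.card_bool]
  rw [← Nat.card_prod, ← hbool]
  -- The Boolean records whether the point is the chosen representative of its class, which
  -- separates the two points of the orbit.
  refine Nat.card_le_card_of_injective
    (fun i => (OrbitPoint.irrepClass i, decide (i.1.1 = (r (OrbitPoint.irrepClass i)).1.1))) ?_
  rintro ⟨x, ζ⟩ ⟨y, ξ⟩ h
  obtain ⟨h1, h2⟩ := Prod.ext_iff.mp h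
  simp only at h1 h2
  obtain ⟨rfl, -⟩ := OrbitPoint.irrepClass_eq h1
  have hx := (OrbitPoint.irrepClass_eq (hr (OrbitPoint.irrepClass (x, ζ))).symm).2
  have hy := (OrbitPoint.irrepClass_eq (hr (OrbitPoint.irrepClass (y, ζ))).symm).2
  rw [← h1] at h2 hy
  rw [decide_eq_decide] at h2
  have hxy : x = y := by
    refine Subtype.ext ?_
    by_cases e : x.1 = (r (OrbitPoint.irrepClass (x, ζ))).1.1
    · rw [e, h2.mp e]
    · rw [hx.resolve_left e, hy.resolve_left (fun e' => e (h2.mpr e'))]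
  rw [hxy]

variable (k m) in
theorem card_indicator_ne_zero_le [IsAlgClosed k] [CharZero k] :
    Nat.card {q : IrrepClass k (BismashJ (2 * m) k) 2 // q.indicator ≠ 0} ≤
      Nat.card {x : OrbitPoint (2 * m) // x.1.1 (x.1.1 2) = 2} *
        Nat.card {ζ : k // ζ ^ m = 1} := by
  have := finite_rootsOfOne k m
  let r := Function.surjInv (OrbitPoint.irrepClass_surjective (k := k) (m := m))
  have hr : ∀ q, OrbitPoint.irrepClass (r q) = q := Function.surjInv_eq _
  rw [← Nat.card_prod]
  refine Nat.card_le_card_of_injective (fun q => (⟨(r q.1).1,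
    OrbitPoint.apply_apply_two_of_indicator_ne_zero (by rw [hr]; exact q.2)⟩, (r q.1).2)) ?_
  intro q q' h
  obtain ⟨h1, h2⟩ := Prod.ext_iff.mp h
  have h3 : r q.1 = r q'.1 := Prod.ext (congrArg Subtype.val h1) h2
  exact Subtype.ext (by rw [← hr q.1, h3, hr])

variable (k m) in
theorem card_indicator_ne_zero_mul_index_le [IsAlgClosed k] [CharZero k] :
    Nat.card {q : IrrepClass k (BismashJ (2 * m) k) 2 // q.indicator ≠ 0} *
      (twoSqSubgroup (2 * m)).index ≤ Nat.card (IrrepClass k (BismashJ (2 * m) k) 2) * 2 :=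
  calc _ ≤ _ := Nat.mul_le_mul_right _ (card_indicator_ne_zero_le k m)
    _ = _ := mul_right_comm _ _ _
    _ ≤ _ := Nat.mul_le_mul_right _ card_selfInverse_mul_index_le
    _ ≤ _ := card_orbitPoint_mul_le k m

-- The 2 in the bound is the size of the orbits, because the proportion was estimated over points
-- and not over orbits.
variable (k m) in
theorem indicator_ratio_le [IsAlgClosed k] [CharZero k] :
    (Nat.card {q : IrrepClass k (BismashJ (2 * m) k) 2 // q.indicator ≠ 0} : ℝ) /
      (Nat.card (IrrepClass k (BismashJ (2 * m) k) 2) : ℝ) ≤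
        2 / ((twoSqSubgroup (2 * m)).index : ℝ) := by
  have hpos : (0 : ℝ) < ((twoSqSubgroup (2 * m)).index : ℝ) :=
    Nat.cast_pos.mpr (Nat.pos_of_ne_zero Subgroup.index_ne_zero_of_finite)
  have h : (Nat.card {q : IrrepClass k (BismashJ (2 * m) k) 2 // q.indicator ≠ 0} : ℝ) *
      ((twoSqSubgroup (2 * m)).index : ℝ) ≤
        (Nat.card (IrrepClass k (BismashJ (2 * m) k) 2) : ℝ) * 2 := by
    exact_mod_cast card_indicator_ne_zero_mul_index_le k m
  refine div_le_of_le_mul₀ (Nat.cast_nonneg _) (by positivity) ?_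
  rw [div_mul_eq_mul_div, le_div_iff₀ hpos]
  linarith

end Count

theorem tendsto_index_twoSqSubgroup :
    Filter.Tendsto (fun m : ℕ+ => (twoSqSubgroup (2 * m)).index) Filter.atTop Filter.atTop := by
  rw [Filter.tendsto_atTop]
  intro K
  filter_upwards [Filter.eventually_ge_atTop (⟨36 ^ K, by positivity⟩ : ℕ+)] with m hm
  have h := le_pow_index_twoSqSubgroup (m : ℕ)
  have hm' : 36 ^ K ≤ (m : ℕ) := hm
  exact (Nat.pow_le_pow_iff_right (by norm_num)).mp (hm'.trans h)

theorem mainTheorem8 (k : Type*) [Field k] [IsAlgClosed k] [CharZero k] :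
    (∀ m : ℕ+, Finite (IrrepClass k (BismashJ (2 * m) k) 2)) ∧
    (∀ m : ℕ+, 3 ≤ m → Nonempty (IrrepClass k (BismashJ (2 * m) k) 2)) ∧
    Filter.Tendsto
      (fun m : ℕ+ =>
        (Nat.card {q : IrrepClass k (BismashJ (2 * m) k) 2 // q.indicator ≠ 0} : ℝ) /
          (Nat.card (IrrepClass k (BismashJ (2 * m) k) 2) : ℝ))
      Filter.atTop (nhds 0) := by
  refine ⟨fun m => finite_irrepClass k m, fun m hm => ?_, ?_⟩
  · obtain ⟨x⟩ := nonempty_orbitPoint (m := m) hm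
    exact ⟨OrbitPoint.irrepClass (x, ⟨1, one_pow _⟩)⟩
  · refine squeeze_zero (fun m => by positivity) (fun m => indicator_ratio_le k m) ?_
    exact Filter.Tendsto.const_div_atTop
      (tendsto_natCast_atTop_atTop.comp tendsto_index_twoSqSubgroup) 2
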